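/- Let $k\ge 1$ be fixed. For $n>k$ let the input $(e_1,\dots,e_n)$ be a uniformly random permutation of $\{1,\dots,n\}$. Its pivots $p_1<\dots<p_k$ are the elements $e_1,\dots,e_k$ in sorted order; put $p_0=0$ and $p_{k+1}=n+1$. An element $x$ with $p_h<x<p_{h+1}$ belongs to group $\mathrm{A}_h$, and $a_h=p_{h+1}-p_h-1$ is the size of group $\mathrm{A}_h$, for $0\le h\le k$. A *comparison tree* $\lambda$ is a binary search tree with $k$ inner nodes labeled $\mathrm p_1,\dots,\mathrm p_k$ in inorder and $k+1$ leaves labeled $\mathrm A_0,\dots,\mathrm A_k$ from left to right; $\Lambda_k$ is the set of all comparison trees. Classifying a non-pivot element means searching for it in $\lambda$, at a cost of one comparison per inner node visited. For group sizes $a_0,\dots,a_k$ that are not all zero put $$c_{\mathrm{avg}}^{\lambda}(a_0,\dots,a_k)=\frac{\sum_{h=0}^k \mathrm{depth}_\lambda(\mathrm A_h)\,a_h}{\sum_{h=0}^k a_h}.$$ A *classification tree* $T$ (for $k$ and $n$) is a $(k+1)$-way tree with $n-k$ levels of inner nodes and one level of leaves. Each inner node $v$ is labeled with an index $i(v)\in\{k+1,\dots,n\}$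 and a comparison tree $\lambda(v)$, the edges out of $v$ are labeled $0,\dots,k$, and on each path from the root to a leaf every index in $\{k+1,\dots,n\}$ occurs exactly once. An input determines a path in $T$: at node $v$, the element $e_{i(v)}$ is classified using $\lambda(v)$, and the edge labeled with the group found is followed. Let $P^T_n$ be the total number of comparisons made along this path, let $F^\lambda$ be the number of nodes on it that are labeled with the comparison tree $\lambda$, and let $f^\lambda_{p_1,\dots,p_k}=\mathrm E(F^\lambda\mid p_1,\dots,p_k)$ be the expected number of times that $\lambda$ is used, given that the pivots are $p_1,\dots,p_k$. Then there are constants $\varepsilon>0$ and $C$, depending only on $k$, such that for all $n>k$ and all classification trees $T$ for $k$ and $n$: 1. for all pivots $1\le p_1<\dots<p_k\le n$, $$\Bigl|\,\mathrm E(P^T_n\mid p_1,\dots,p_k)-\sum_{\lambda\in\Lambda_k} f^{\lambda}_{p_1,\dots,p_k}\cdot c_{\mathrm{avg}}^{\lambda}(a_0,\dots,a_k)\Bigr|\le C\,n^{1-\varepsilon};$$ 2. averaged over all choices of the pivots, $$\Bigl|\,\mathrm E(P^T_n)-\frac1{\binom nk}\sum_{1\le p_1<\dots<p_k\le n}\ \sum_{\lambda\in\Lambda_k}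 f^{\lambda}_{p_1,\dots,p_k}\cdot c_{\mathrm{avg}}^{\lambda}(a_0,\dots,a_k)\Bigr|\le C\,n^{1-\varepsilon}.$$ -/

import Mathlib

namespace MultiPivot

/-! ### Comparison trees -/

/-- A comparison tree for `k` pivots: a binary search tree with `k` inner nodes. The labels are
determined by the shape: the inner nodes are `p_1, …, p_k` in inorder, the leaves are
`A_0, …, A_k` from left to right. The type is the finite set `Λ_k`. -/
abbrev ComparisonTree (k : ℕ) : Type := {t : BinaryTree Unit // t ∈ BinaryTree.treesOfNumNodesEq k}

/-- Searching for `x` in a binary search tree whose inner nodes are labeled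
`p (o + 1), p (o + 2), …` in inorder and whose leaves are labeled `o, o + 1, …` from left to right.
Result: the label of the leaf that is reached, and the number of comparisons made. -/
def search (x : ℕ) (p : ℕ → ℕ) : BinaryTree Unit → ℕ → ℕ × ℕ
  | .nil, o => (o, 0)
  | .node _ l r, o =>
      let m := o + l.numNodes + 1
      let s := if x < p m then search x p l o else search x p r m
      (s.1, s.2 + 1)

theorem search_fst_le (x : ℕ) (p : ℕ → ℕ) (t : BinaryTree Unit) (o : ℕ) :
    (search x p t o).1 ≤ o + t.numNodes := by
  induction t generalizing o with
  | nil => simp [search]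
  | node _ l r ihl ihr =>
    have h1 := ihl o
    have h2 := ihr (o + l.numNodes + 1)
    simp only [search, BinaryTree.numNodes]
    split_ifs <;> omega

/-- The group `h ∈ {0, …, k}` to which the comparison tree `lam` assigns `x`. -/
def outcome {k : ℕ} (lam : ComparisonTree k) (p : ℕ → ℕ) (x : ℕ) : Fin (k + 1) :=
  ⟨(search x p lam.1 0).1, by
    have h := search_fst_le x p lam.1 0
    have h' := BinaryTree.mem_treesOfNumNodesEq.1 lam.2
    omega⟩

/-- The number of comparisons that `lam` makes to classify `x`. -/
def numComparisons {k : ℕ} (lam : ComparisonTree k) (p : ℕ → ℕ) (x : ℕ) : ℕ :=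
  (search x p lam.1 0).2

/-- The depth of the `h`-th leaf from the left (counted from `0`) in a binary tree. -/
def leafDepth : BinaryTree Unit → ℕ → ℕ
  | .nil, _ => 0
  | .node _ l r, h =>
      if h ≤ l.numNodes then leafDepth l h + 1 else leafDepth r (h - (l.numNodes + 1)) + 1

/-- The cost of `lam` on group sizes `a_0, …, a_k`: the sum of `depth(A_h) * a_h`. -/
def cost {k : ℕ} (lam : ComparisonTree k) (a : Fin (k + 1) → ℕ) : ℕ :=
  ∑ h : Fin (k + 1), leafDepth lam.1 h * a h

/-- The average cost of `lam` on group sizes `a_0, …, a_k`. -/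
noncomputable def avgCost {k : ℕ} (lam : ComparisonTree k) (a : Fin (k + 1) → ℕ) : ℝ :=
  (cost lam a : ℝ) / ∑ h, (a h : ℝ)

/-! ### Inputs and pivots

An input is a permutation `σ` of `Fin n`; with positions and values both shifted by one it is
`(e_1, …, e_n)`, where `e_{i+1} = σ i + 1`. -/

/-- The set of the first `k` elements of the input. -/
def pivotSet {n : ℕ} (k : ℕ) (σ : Equiv.Perm (Fin n)) : Finset (Fin n) :=
  (Finset.univ.filter fun i : Fin n => (i : ℕ) < k).image σ

theorem card_pivotSet {n k : ℕ} (hk : k ≤ n) (σ : Equiv.Perm (Fin n)) :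
    (pivotSet k σ).card = k := by
  rw [pivotSet, Finset.card_image_of_injective _ σ.injective, Fin.card_filter_val_lt]
  exact min_eq_right hk

/-- The pivots of the input: its first `k` elements in increasing order. -/
def pivots {n k : ℕ} (hk : k ≤ n) (σ : Equiv.Perm (Fin n)) : Fin k → Fin n :=
  (pivotSet k σ).orderEmbOfFin (card_pivotSet hk σ)

/-- The sequence `p_0 = 0, p_1, …, p_k, p_{k+1} = n + 1` of pivot values in `{1, …, n}`,
completed by the two sentinels. -/
def pivotSeq {n k : ℕ} (p : Fin k → Fin n) : ℕ → ℕ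
  | 0 => 0
  | j + 1 => if h : j < k then (p ⟨j, h⟩ : ℕ) + 1 else n + 1

/-- The group sizes `a_h = p_{h+1} - p_h - 1`. -/
def groupSize {n k : ℕ} (p : Fin k → Fin n) (h : Fin (k + 1)) : ℕ :=
  pivotSeq p (h + 1) - pivotSeq p h - 1

/-! ### Classification trees -/

/-- A `(k+1)`-way tree whose inner nodes are labeled with an input position and a comparison tree. -/
inductive ClassTree (k n : ℕ) : Type
  | leaf : ClassTree k n
  | node (i : Fin n) (lam : ComparisonTree k) (child : Fin (k + 1) → ClassTree k n) : ClassTree k n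

namespace ClassTree

variable {k n : ℕ}

/-- On every path from the root to a leaf, the indices that occur are exactly those in `S`, each of
them exactly once. -/
def CoversOnce : ClassTree k n → Finset (Fin n) → Prop
  | leaf, S => S = ∅
  | node i _ child, S => i ∈ S ∧ ∀ h, (child h).CoversOnce (S.erase i)

/-- Classification trees: on every path from the root to a leaf, each non-pivot position
`k + 1, …, n` (here `k, …, n - 1`) occurs exactly once. In particular there are `n - k` levels of
inner nodes. -/
def IsClassificationTree (T : ClassTree k n) : Prop :=
  T.CoversOnce (Finset.univ.filter fun i : Fin n => k ≤ (i : ℕ))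

/-- The number of comparisons made along the path that the input `σ` determines in the tree, when
the pivots are given by `p`. -/
def comparisons (p : ℕ → ℕ) (σ : Equiv.Perm (Fin n)) : ClassTree k n → ℕ
  | leaf => 0
  | node i lam child =>
      numComparisons lam p (σ i + 1) + comparisons p σ (child (outcome lam p (σ i + 1)))

/-- The number of nodes labeled with the comparison tree `mu` on the path that the input `σ`
determines in the tree, when the pivots are given by `p`. -/
def uses (p : ℕ → ℕ) (σ : Equiv.Perm (Fin n)) (mu : ComparisonTree k) : ClassTree k n → ℕ
  | leaf => 0
  | node i lam child =>
      (if lam = mu then 1 else 0) + uses p σ mu (child (outcome lam p (σ i + 1)))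

/-- The random variable `P^T_n`: comparisons made when classifying the input `σ` using `T`. -/
def partitionCost (hk : k ≤ n) (T : ClassTree k n) (σ : Equiv.Perm (Fin n)) : ℕ :=
  T.comparisons (pivotSeq (pivots hk σ)) σ

/-- The random variable `F^λ`: how often `lam` is used when classifying the input `σ` using `T`. -/
def treeUses (hk : k ≤ n) (T : ClassTree k n) (lam : ComparisonTree k)
    (σ : Equiv.Perm (Fin n)) : ℕ :=
  T.uses (pivotSeq (pivots hk σ)) σ lam

end ClassTree

/-! ### Expectations over a uniformly random input -/

/-- The expectation of `X` over a uniformly random permutation. -/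
noncomputable def expectation {n : ℕ} (X : Equiv.Perm (Fin n) → ℕ) : ℝ :=
  (∑ σ, (X σ : ℝ)) / (Fintype.card (Equiv.Perm (Fin n)) : ℝ)

/-- The conditional expectation of `X` over a uniformly random permutation, given that the sorted
pivots are `p`. -/
noncomputable def condExpectation {n k : ℕ} (hk : k ≤ n) (p : Fin k → Fin n)
    (X : Equiv.Perm (Fin n) → ℕ) : ℝ :=
  (∑ σ with pivots hk σ = p, (X σ : ℝ)) /
    ((Finset.univ.filter fun σ : Equiv.Perm (Fin n) => pivots hk σ = p).card : ℝ)

open Classical in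
/-- All choices `1 ≤ p_1 < ⋯ < p_k ≤ n` of the pivots. -/
noncomputable def pivotChoices (k n : ℕ) : Finset (Fin k → Fin n) :=
  Finset.univ.filter fun p => StrictMono p

/-- The sum over `λ ∈ Λ_k` of `f^λ_p * c_avg^λ(a_0, …, a_k)`, where
`f^λ_p = E(F^λ | p)` and `a_0, …, a_k` are the group sizes of the pivots `p`. -/
noncomputable def treeSum {n k : ℕ} (hk : k ≤ n) (T : ClassTree k n) (p : Fin k → Fin n) : ℝ :=
  ∑ lam : ComparisonTree k,
    condExpectation hk p (T.treeUses hk lam) * avgCost lam (groupSize p)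

end MultiPivot

/-!
The theorem holds with `ε = 1 / 2` and `C = 2 * k * (k + 1)`.

Fix the pivots and also the order in which they occur. The remaining values then come in uniformly
random order, so reading positions in the adaptive order prescribed by the tree is drawing values
without replacement (`sum_agreeOff`). If `N` values remain, `r_h` of them in group `h`, then a use of
`λ` has conditional expected cost `∑ depth(A_h) * r_h / N`, whereas it is charged
`c_avg^λ = ∑ depth(A_h) * α_h` with `α_h = a_h / (n - k)`. The difference is at most
`k / N * ∑ |D_h|`, where `D_h = r_h - α_h * N`, no matter which `λ` the tree chooses.

The accumulated difference is controlled by a potential. The proportions `r_h / N` form a martingale,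
and one draw gives `E D'² = D² * (1 - 1 / N)² + (r / N) * (1 - r / N)`. From this,
`Ψ(N, D) = D² / √N + 2 * √N` satisfies `|D| / N + E Ψ(N - 1, D') ≤ Ψ(N, D)`
(`abs_add_potential_le`). Induction on the tree (`abs_sum_excess_le`) bounds the expected excess by
`k * ∑ Ψ(n - k, D_h)`, and at the start all `D_h` vanish, which leaves `2 * k * (k + 1) * √(n - k)`.

The averaged claim follows because every choice of the pivots is equally likely (`card_pivots_eq`).
-/

namespace MultiPivot

open Finset

/-! ### Searching in a comparison tree -/

/-- The group that the search finds does not depend on the shape of the tree. -/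
theorem search_eq (x : ℕ) (q : ℕ → ℕ) (t : BinaryTree Unit) (o g : ℕ) (hog : o ≤ g)
    (hgt : g ≤ o + t.numNodes) (hle : ∀ j, o < j → j ≤ g → q j ≤ x)
    (hlt : ∀ j, g < j → j ≤ o + t.numNodes → x < q j) :
    search x q t o = (g, leafDepth t (g - o)) := by
  induction t generalizing o with
  | nil =>
    simp only [BinaryTree.numNodes] at hgt
    simp [search, leafDepth]
    omega
  | node _ l r ihl ihr =>
    simp only [BinaryTree.numNodes] at hgt hlt
    simp only [search, leafDepth]
    by_cases h : g ≤ o + l.numNodes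
    · rw [if_pos (hlt _ (by omega) (by omega)), if_pos (by omega),
        ihl o hog h hle fun j h1 h2 => hlt j h1 (by omega)]
    · rw [if_neg (not_lt.2 (hle _ (by omega) (by omega))), if_neg (by omega),
        ihr _ (by omega) (by omega) (fun j h1 h2 => hle j (by omega) h2)
          fun j h1 h2 => hlt j h1 (by omega)]
      simp [Nat.sub_sub, Nat.add_assoc]

theorem leafDepth_le_numNodes (t : BinaryTree Unit) (h : ℕ) : leafDepth t h ≤ t.numNodes := by
  induction t generalizing h with
  | nil => simp [leafDepth]
  | node _ l r ihl ihr =>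
    have h1 := ihl h
    have h2 := ihr (h - (l.numNodes + 1))
    simp only [leafDepth, BinaryTree.numNodes]
    split_ifs <;> omega

theorem leafDepth_le {k : ℕ} (lam : ComparisonTree k) (h : ℕ) : leafDepth lam.1 h ≤ k :=
  (leafDepth_le_numNodes _ _).trans_eq (BinaryTree.mem_treesOfNumNodesEq.1 lam.2)

/-! ### Pivots and groups -/

section Pivots

variable {n k : ℕ}

theorem pivotSeq_succ (p : Fin k → Fin n) (j : Fin k) : pivotSeq p (j + 1) = p j + 1 := by
  simp [pivotSeq]

theorem pivotSeq_last (p : Fin k → Fin n) : pivotSeq p (k + 1) = n + 1 := by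
  simp [pivotSeq]

theorem pivotSeq_lt_succ {p : Fin k → Fin n} (hp : StrictMono p) {j : ℕ} (hj : j ≤ k) :
    pivotSeq p j < pivotSeq p (j + 1) := by
  rcases j with _ | j
  · by_cases h : 0 < k <;> simp [pivotSeq, h]
  · have h : j < k := hj
    by_cases h' : j + 1 < k
    · have : p ⟨j, h⟩ < p ⟨j + 1, h'⟩ := hp (by simp [Fin.lt_def])
      simp [pivotSeq, h, h', this]
    · simp [pivotSeq, h, h']

theorem pivotSeq_mono {p : Fin k → Fin n} (hp : StrictMono p) {i j : ℕ} (hij : i ≤ j)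
    (hj : j ≤ k + 1) : pivotSeq p i ≤ pivotSeq p j := by
  induction j, hij using Nat.le_induction with
  | base => rfl
  | succ j _ ih => exact (ih (by omega)).trans (pivotSeq_lt_succ hp (by omega)).le

/-- The group of the value `v + 1`: the largest `h ≤ k` with `p_h ≤ v + 1`. A pivot `p_h` is
counted in group `h`. -/
def group (p : Fin k → Fin n) (v : Fin n) : Fin (k + 1) :=
  ⟨Nat.findGreatest (fun h => pivotSeq p h ≤ v + 1) k,
    Nat.lt_succ_of_le (Nat.findGreatest_le _)⟩

theorem pivotSeq_group_le (p : Fin k → Fin n) (v : Fin n) : pivotSeq p (group p v) ≤ v + 1 :=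
  Nat.findGreatest_spec (P := fun h => pivotSeq p h ≤ v + 1) (Nat.zero_le k) (by simp [pivotSeq])

theorem lt_pivotSeq_of_group_lt (p : Fin k → Fin n) (v : Fin n) {j : ℕ} (hj : group p v < j)
    (hjk : j ≤ k + 1) : (v : ℕ) + 1 < pivotSeq p j := by
  rcases hjk.lt_or_eq with h | rfl
  · exact not_le.1 (Nat.findGreatest_is_greatest (P := fun h => pivotSeq p h ≤ v + 1) hj
      (by omega))
  · rw [pivotSeq_last]
    omega

theorem group_eq_iff {p : Fin k → Fin n} (hp : StrictMono p) (v : Fin n) (h : Fin (k + 1)) :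
    group p v = h ↔ pivotSeq p h ≤ v + 1 ∧ (v : ℕ) + 1 < pivotSeq p (h + 1) := by
  constructor
  · rintro rfl
    exact ⟨pivotSeq_group_le p v, lt_pivotSeq_of_group_lt p v (Nat.lt_succ_self _) (by omega)⟩
  · rintro ⟨h1, h2⟩
    have h3 := pivotSeq_group_le p v
    rcases lt_trichotomy (group p v) h with hlt | heq | hgt
    · exact absurd (lt_pivotSeq_of_group_lt p v hlt (by omega)) (by omega)
    · exact heq
    · have := pivotSeq_mono hp (i := h + 1) (j := group p v) hgt (by omega)
      omega

theorem search_pivotSeq {p : Fin k → Fin n} (hp : StrictMono p) (lam : ComparisonTree k)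
    (v : Fin n) : search (v + 1) (pivotSeq p) lam.1 0 =
      ((group p v : ℕ), leafDepth lam.1 (group p v)) := by
  have hn := BinaryTree.mem_treesOfNumNodesEq.1 lam.2
  exact search_eq _ _ _ 0 (group p v) (Nat.zero_le _) (by omega)
    (fun j _ hj => (pivotSeq_mono hp hj (by omega)).trans (pivotSeq_group_le p v))
    fun j hj hj' => lt_pivotSeq_of_group_lt p v hj (by omega)

theorem outcome_pivotSeq {p : Fin k → Fin n} (hp : StrictMono p) (lam : ComparisonTree k)
    (v : Fin n) : outcome lam (pivotSeq p) (v + 1) = group p v :=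
  Fin.ext (by simp [outcome, search_pivotSeq hp])

theorem numComparisons_pivotSeq {p : Fin k → Fin n} (hp : StrictMono p) (lam : ComparisonTree k)
    (v : Fin n) : numComparisons lam (pivotSeq p) (v + 1) = leafDepth lam.1 (group p v) := by
  simp [numComparisons, search_pivotSeq hp]

/-- Among the values that are not pivots, group `h` has `a_h` elements. -/
theorem card_group_eq {p : Fin k → Fin n} (hp : StrictMono p) (h : Fin (k + 1)) :
    #{v ∈ (univ.image p)ᶜ | group p v = h} = groupSize p h := by
  have key : ({v ∈ (univ.image p)ᶜ | group p v = h}).map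
      (Fin.valEmbedding.trans (addRightEmbedding 1)) =
      Ioo (pivotSeq p h) (pivotSeq p (h + 1)) := by
    ext x
    simp only [mem_map, mem_filter, mem_compl, mem_image, mem_univ, true_and, group_eq_iff hp,
      not_exists, mem_Ioo, Function.Embedding.trans_apply, Fin.valEmbedding_apply,
      addRightEmbedding_apply]
    constructor
    · rintro ⟨v, ⟨hv, h1, h2⟩, rfl⟩
      refine ⟨lt_of_le_of_ne h1 fun heq => ?_, h2⟩
      obtain ⟨_ | h, hh⟩ := h
      · simp [pivotSeq] at heq
      · refine hv ⟨h, by omega⟩ (Fin.ext ?_)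
        have := pivotSeq_succ p ⟨h, by omega⟩
        simp only at heq this
        omega
    · rintro ⟨h1, h2⟩
      have h3 := pivotSeq_mono hp (i := h + 1) (j := k + 1) (by omega) le_rfl
      rw [pivotSeq_last] at h3
      refine ⟨⟨x - 1, by omega⟩, ⟨fun j hj => ?_, ?_, ?_⟩, by simp only; omega⟩
      · have h4 := pivotSeq_succ p j
        have h5 : ((p j : ℕ)) = x - 1 := by rw [hj]
        rcases Nat.lt_or_ge j h with hlt | hge
        · have := pivotSeq_mono hp (i := j + 1) (j := h) hlt (by omega)
          omega
        · have := pivotSeq_mono hp (i := h + 1) (j := j + 1) (by omega) (by omega)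
          omega
      · simp only; omega
      · simp only; omega
  rw [← card_map, key, Nat.card_Ioo, groupSize]

theorem pivots_strictMono (hk : k ≤ n) (σ : Equiv.Perm (Fin n)) : StrictMono (pivots hk σ) :=
  (Finset.orderEmbOfFin _ _).strictMono

theorem image_pivots (hk : k ≤ n) (σ : Equiv.Perm (Fin n)) :
    univ.image (pivots hk σ) = pivotSet k σ :=
  Finset.image_orderEmbOfFin_univ _ _

theorem pivots_eq_iff (hk : k ≤ n) (σ : Equiv.Perm (Fin n)) {p : Fin k → Fin n}
    (hp : StrictMono p) : pivots hk σ = p ↔ pivotSet k σ = univ.image p := by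
  constructor
  · rintro rfl
    exact (image_pivots hk σ).symm
  · intro h
    refine (Finset.orderEmbOfFin_unique (card_pivotSet hk σ) (fun x => ?_) hp).symm
    rw [h]
    exact mem_image_of_mem _ (mem_univ _)

theorem mem_pivotChoices {p : Fin k → Fin n} : p ∈ pivotChoices k n ↔ StrictMono p := by
  simp [pivotChoices]

theorem card_pivotChoices (k n : ℕ) : #(pivotChoices k n) = n.choose k := by
  have hcard : #(powersetCard k (univ : Finset (Fin n))) = n.choose k := by simp
  rw [← hcard]
  refine Finset.card_bij (fun p _ => univ.image p) ?_ ?_ ?_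
  · intro p hp
    rw [mem_powersetCard_univ, card_image_of_injective _ (mem_pivotChoices.1 hp).injective]
    simp
  · intro p hp q hq h
    have hc : #(univ.image q) = k := by
      rw [card_image_of_injective _ (mem_pivotChoices.1 hq).injective]
      simp
    refine (Finset.orderEmbOfFin_unique hc (fun x => ?_) (mem_pivotChoices.1 hp)).trans
      (Finset.orderEmbOfFin_unique hc (fun x => ?_) (mem_pivotChoices.1 hq)).symm
    · rw [← h]
      exact mem_image_of_mem _ (mem_univ _)
    · exact mem_image_of_mem _ (mem_univ _)
  · intro s hs
    rw [mem_powersetCard_univ] at hs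
    exact ⟨s.orderEmbOfFin hs, mem_pivotChoices.2 (s.orderEmbOfFin hs).strictMono,
      Finset.image_orderEmbOfFin_univ _ _⟩

theorem pivotSet_mul (k : ℕ) (π σ : Equiv.Perm (Fin n)) :
    pivotSet k (π * σ) = (pivotSet k σ).image π := by
  simp [pivotSet, image_image, Equiv.Perm.coe_mul]

/-- Relabeling the values by a permutation that maps one set of pivots to the other is a bijection
between the inputs. -/
theorem card_pivots_eq_of_strictMono (hk : k ≤ n) {p q : Fin k → Fin n} (hp : StrictMono p)
    (hq : StrictMono q) : #{σ | pivots hk σ = p} = #{σ | pivots hk σ = q} := by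
  let e : {v // v ∈ Set.range p} ≃ {v // v ∈ Set.range q} :=
    (Equiv.ofInjective p hp.injective).symm.trans (Equiv.ofInjective q hq.injective)
  have hπ : (univ.image p).image e.extendSubtype = univ.image q := by
    rw [image_image]
    refine image_congr fun j _ => ?_
    have h := e.extendSubtype_apply_of_mem (p j) ⟨j, rfl⟩
    rw [Function.comp_apply, h]
    have h' : (Equiv.ofInjective p hp.injective).symm ⟨p j, ⟨j, rfl⟩⟩ = j :=
      Equiv.ofInjective_symm_apply _ _
    simp [e, h']
  refine Finset.card_equiv (Equiv.mulLeft e.extendSubtype) fun σ => ?_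
  simp only [mem_filter, mem_univ, true_and, pivots_eq_iff hk _ hp, pivots_eq_iff hk _ hq,
    Equiv.coe_mulLeft, pivotSet_mul, ← hπ]
  exact (image_injective e.extendSubtype.injective).eq_iff.symm

/-- Every choice of pivots is equally likely. -/
theorem card_pivots_eq (hk : k ≤ n) {p : Fin k → Fin n} (hp : StrictMono p) :
    n.choose k * #{σ | pivots hk σ = p} = Fintype.card (Equiv.Perm (Fin n)) := by
  have h := Finset.card_eq_sum_card_fiberwise (s := univ) (t := pivotChoices k n)
    (f := pivots hk) fun σ _ => mem_pivotChoices.2 (pivots_strictMono hk σ)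
  rw [← card_univ, h, sum_congr rfl fun q hq =>
    card_pivots_eq_of_strictMono hk (mem_pivotChoices.1 hq) hp, sum_const, card_pivotChoices,
    smul_eq_mul]

theorem expectation_eq_sum_condExpectation (hk : k ≤ n) (X : Equiv.Perm (Fin n) → ℕ) :
    expectation X = 1 / (n.choose k : ℝ) * ∑ p ∈ pivotChoices k n, condExpectation hk p X := by
  rw [expectation, mul_sum, ← sum_fiberwise_of_maps_to (s := univ) (t := pivotChoices k n)
    (g := pivots hk) (fun σ _ => mem_pivotChoices.2 (pivots_strictMono hk σ)), sum_div]
  refine sum_congr rfl fun p hp => ?_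
  rw [condExpectation, ← card_pivots_eq hk (mem_pivotChoices.1 hp), Nat.cast_mul, div_mul_div_comm,
    one_mul]

end Pivots

/-! ### The potential -/

section RealInequality

/-- The potential of a deviation `D` when `N` elements remain. -/
noncomputable def potential (N : ℕ) (D : ℝ) : ℝ := D ^ 2 / √N + 2 * √N

/-- The potential pays for the deviation in every draw: from `N + 1` values, `r` of them in the group
considered, one is drawn. The inequality is multiplied by `N + 1`, so that its weights count the
possible draws. -/
theorem abs_add_potential_le (N : ℕ) (r α : ℝ) (hrN : r ≤ N + 1) :
    |r - α * (N + 1)| + (r * potential N (r - 1 - α * N) + (N + 1 - r) * potential N (r - α * N)) ≤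
      (N + 1) * potential (N + 1) (r - α * (N + 1)) := by
  have hN : (0 : ℝ) ≤ N := N.cast_nonneg
  obtain ⟨D, hD⟩ : ∃ D, D = r - α * (N + 1) := ⟨_, rfl⟩
  obtain ⟨u, hu⟩ : ∃ u, u = √(N : ℝ) := ⟨_, rfl⟩
  obtain ⟨s, hs⟩ : ∃ s, s = √((N : ℝ) + 1) := ⟨_, rfl⟩
  have hu0 : 0 ≤ u := hu ▸ Real.sqrt_nonneg _
  have hs0 : 0 < s := hs ▸ Real.sqrt_pos.2 (by positivity)
  have hu2 : u ^ 2 = N := hu ▸ Real.sq_sqrt hN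
  have hs2 : s ^ 2 = N + 1 := hs ▸ Real.sq_sqrt (by positivity)
  have hus : u ≤ s := by rw [hu, hs]; exact Real.sqrt_le_sqrt (by linarith)
  simp only [potential, Nat.cast_add, Nat.cast_one, ← hD, ← hu, ← hs]
  -- The geometric-arithmetic mean inequality makes the deviation quadratic.
  have habs : |D| ≤ D ^ 2 / s / 2 + s / 2 := by
    have h : D ^ 2 / s + s - 2 * |D| = (|D| - s) ^ 2 / s := by
      field_simp
      rw [sub_sq, sq_abs]
      ring
    have : 0 ≤ (|D| - s) ^ 2 / s := by positivity
    linarith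
  -- The second moment of the deviation after one draw without replacement.
  have hmoment : r * (r - 1 - α * N) ^ 2 + (N + 1 - r) * (r - α * N) ^ 2 =
      D ^ 2 * N ^ 2 / (N + 1) + r * (N + 1 - r) / (N + 1) := by
    rw [hD]
    field_simp
    ring
  have hsq : D ^ 2 * N ^ 2 / (N + 1) / u ≤ N * (D ^ 2 / s) := by
    -- For `u = 0` the quotient is `0` by convention; this is the last draw.
    rcases hu0.eq_or_lt with h | h
    · rw [← h, div_zero]; positivity
    · rw [← hs2, ← hu2]
      have h1 : D ^ 2 * (u ^ 2) ^ 2 / s ^ 2 / u = (u ^ 2 * (D ^ 2 / s)) * (u / s) := by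
        field_simp
      rw [h1]
      exact mul_le_of_le_one_right (by positivity) ((div_le_one hs0).2 hus)
  have hvar : r * (N + 1 - r) / (N + 1) / u ≤ s / 2 := by
    rcases hu0.eq_or_lt with h | h
    · rw [← h, div_zero]; positivity
    · have hN1 : (1 : ℝ) ≤ N := by
        have h0 : N ≠ 0 := by
          rintro rfl
          simp at hu2
          exact h.ne' hu2
        exact_mod_cast Nat.one_le_iff_ne_zero.2 h0
      have hs2u : s ≤ 2 * u := by
        refine le_of_sq_le_sq ?_ (by positivity)
        nlinarith
      rw [div_div, div_le_iff₀ (by positivity)]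
      have h1 : r * (N + 1 - r) ≤ (N + 1) ^ 2 / 4 := by nlinarith [sq_nonneg (N + 1 - 2 * r)]
      have h2 : (N + 1) * (s * s) ≤ (N + 1) * (s * (2 * u)) := by gcongr
      nlinarith
  have hdrop : s ≤ 2 * (N + 1) * (s - u) := by
    have h1 : (s - u) * (s + u) = 1 := by nlinarith
    have h2 : s * 1 ≤ s * ((s - u) * (2 * s)) := by
      rw [← h1]
      gcongr
      linarith
    nlinarith
  calc _ = |D| + (r * (r - 1 - α * N) ^ 2 + (N + 1 - r) * (r - α * N) ^ 2) / u
        + 2 * (N + 1) * u := by ring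
    _ ≤ (N + 1) * (D ^ 2 / s) + 2 * (N + 1) * s := by
        rw [hmoment, add_div]
        have : 0 ≤ D ^ 2 / s := by positivity
        linarith
    _ = _ := by ring

end RealInequality

/-! ### Drawing without replacement -/

section Resampling

variable {n : ℕ}

/-- The permutations that agree with `τ` outside `S`. -/
def agreeOff (S : Finset (Fin n)) (τ : Equiv.Perm (Fin n)) : Finset (Equiv.Perm (Fin n)) :=
  {σ | ∀ j, j ∉ S → σ j = τ j}

theorem mem_agreeOff {S : Finset (Fin n)} {τ σ : Equiv.Perm (Fin n)} :
    σ ∈ agreeOff S τ ↔ ∀ j, j ∉ S → σ j = τ j := by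
  simp [agreeOff]

theorem mem_agreeOff_comm {S : Finset (Fin n)} {τ σ : Equiv.Perm (Fin n)} :
    σ ∈ agreeOff S τ ↔ τ ∈ agreeOff S σ := by
  simp [mem_agreeOff, eq_comm]

theorem mem_agreeOff_erase {S : Finset (Fin n)} {i j : Fin n} (hi : i ∈ S) (hj : j ∈ S)
    {τ σ : Equiv.Perm (Fin n)} :
    σ ∈ agreeOff (S.erase i) (τ * Equiv.swap i j) ↔ σ ∈ agreeOff S τ ∧ σ i = τ j := by
  simp only [mem_agreeOff, mem_erase, Equiv.Perm.coe_mul, Function.comp_apply]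
  constructor
  · intro h
    refine ⟨fun l hl => ?_, ?_⟩
    · rw [h l fun h' => hl h'.2, Equiv.swap_apply_of_ne_of_ne] <;> rintro rfl <;> contradiction
    · rw [h i (by simp), Equiv.swap_apply_left]
  · rintro ⟨h, h'⟩ l hl
    by_cases hli : l = i
    · rw [hli, h', Equiv.swap_apply_left]
    · have hlS : l ∉ S := fun hlS => hl ⟨hli, hlS⟩
      rw [h l hlS, Equiv.swap_apply_of_ne_of_ne hli]
      rintro rfl
      contradiction

/-- Drawing the value at position `i` first: it is the value of `τ` at some position `j ∈ S`, and
the remaining positions are then filled with the remaining values. -/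
theorem sum_agreeOff {M : Type*} [AddCommMonoid M] {S : Finset (Fin n)} {i : Fin n} (hi : i ∈ S)
    (τ : Equiv.Perm (Fin n)) (f : Equiv.Perm (Fin n) → M) :
    ∑ σ ∈ agreeOff S τ, f σ =
      ∑ j ∈ S, ∑ σ ∈ agreeOff (S.erase i) (τ * Equiv.swap i j), f σ := by
  rw [← sum_fiberwise_of_maps_to (s := agreeOff S τ) (t := S) (g := fun σ => τ.symm (σ i))]
  · refine sum_congr rfl fun j hj => sum_congr ?_ fun _ _ => rfl
    ext σ
    rw [mem_agreeOff_erase hi hj, mem_filter, Equiv.symm_apply_eq]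
  · intro σ hσ
    by_contra h
    have h1 := mem_agreeOff.1 hσ _ h
    rw [Equiv.apply_symm_apply] at h1
    rw [σ.injective h1] at h
    exact h hi

theorem card_agreeOff (S : Finset (Fin n)) (τ : Equiv.Perm (Fin n)) :
    #(agreeOff S τ) = (#S).factorial := by
  induction hN : #S generalizing S τ with
  | zero =>
    rw [card_eq_zero] at hN
    subst hN
    rw [Nat.factorial_zero, card_eq_one]
    refine ⟨τ, ?_⟩
    ext σ
    simp [mem_agreeOff, Equiv.ext_iff]
  | succ N ih =>
    obtain ⟨i, hi⟩ := card_pos.1 (by omega : 0 < #S)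
    have hc : #(S.erase i) = N := by rw [card_erase_of_mem hi, hN, Nat.add_sub_cancel]
    rw [card_eq_sum_ones, sum_agreeOff hi]
    simp only [← card_eq_sum_ones, ih _ _ hc]
    rw [sum_const, hN, smul_eq_mul, Nat.factorial_succ]

/-- Removing the value drawn at position `i` from the values that are still to be placed. -/
theorem sum_erase_mul_swap {M : Type*} [AddCommGroup M] {S : Finset (Fin n)} {i j : Fin n}
    (hi : i ∈ S) (hj : j ∈ S) (τ : Equiv.Perm (Fin n)) (f : Fin n → M) :
    ∑ l ∈ S.erase i, f ((τ * Equiv.swap i j) l) = ∑ l ∈ S, f (τ l) - f (τ j) := by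
  rw [sum_erase_eq_sub hi]
  congr 1
  · refine sum_equiv (Equiv.swap i j) (fun l => ?_) fun l _ => rfl
    rcases eq_or_ne l i with rfl | hli
    · simp [hi, hj]
    rcases eq_or_ne l j with rfl | hlj
    · simp [hi, hj]
    rw [Equiv.swap_apply_of_ne_of_ne hli hlj]
  · simp

end Resampling

/-! ### The excess over the charged costs -/

section Excess

variable {n k : ℕ}

/-- The comparisons made along the path of `σ`, minus a charge of `c lam` for each use of `lam`. -/
noncomputable def excess (q : ℕ → ℕ) (c : ComparisonTree k → ℝ) (T : ClassTree k n)
    (σ : Equiv.Perm (Fin n)) : ℝ :=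
  T.comparisons q σ - ∑ lam : ComparisonTree k, T.uses q σ lam * c lam

theorem excess_leaf (q : ℕ → ℕ) (c : ComparisonTree k → ℝ) (σ : Equiv.Perm (Fin n)) :
    excess q c ClassTree.leaf σ = 0 := by
  simp [excess, ClassTree.comparisons, ClassTree.uses]

theorem excess_node (q : ℕ → ℕ) (c : ComparisonTree k → ℝ) (i : Fin n) (lam : ComparisonTree k)
    (child : Fin (k + 1) → ClassTree k n) (σ : Equiv.Perm (Fin n)) :
    excess q c (.node i lam child) σ = numComparisons lam q (σ i + 1) - c lam +
      excess q c (child (outcome lam q (σ i + 1))) σ := by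
  simp only [excess, ClassTree.comparisons, ClassTree.uses, Nat.cast_add, add_mul,
    sum_add_distrib, Nat.cast_ite, Nat.cast_one, Nat.cast_zero, ite_mul, one_mul, zero_mul,
    sum_ite_eq, mem_univ, if_true]
  ring

/-- How far the number of values of group `h` that `τ` has at the positions in `S` is from the
share `α h` of all these values. -/
def deviation (p : Fin k → Fin n) (α : Fin (k + 1) → ℝ) (S : Finset (Fin n))
    (τ : Equiv.Perm (Fin n)) (h : Fin (k + 1)) : ℝ :=
  ∑ l ∈ S, (if group p (τ l) = h then 1 else 0) - α h * #S

theorem deviation_erase_mul_swap (p : Fin k → Fin n) (α : Fin (k + 1) → ℝ) {S : Finset (Fin n)}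
    {i j : Fin n} (hi : i ∈ S) (hj : j ∈ S) (τ : Equiv.Perm (Fin n)) (h : Fin (k + 1)) :
    deviation p α (S.erase i) (τ * Equiv.swap i j) h =
      ∑ l ∈ S, (if group p (τ l) = h then 1 else 0) - (if group p (τ j) = h then 1 else 0) -
        α h * #(S.erase i) := by
  rw [deviation, sum_erase_mul_swap hi hj τ fun v => if group p v = h then (1 : ℝ) else 0]

theorem sum_potential_erase_add_abs_le (p : Fin k → Fin n) (α : Fin (k + 1) → ℝ)
    {S : Finset (Fin n)} {i : Fin n} (hi : i ∈ S) (τ : Equiv.Perm (Fin n)) (h : Fin (k + 1)) :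
    |deviation p α S τ h| + ∑ j ∈ S, potential #(S.erase i)
        (deviation p α (S.erase i) (τ * Equiv.swap i j) h) ≤
      #S * potential #S (deviation p α S τ h) := by
  obtain ⟨N, hN⟩ : ∃ N, #S = N + 1 := ⟨#S - 1, by have := card_pos.2 ⟨i, hi⟩; omega⟩
  have hc : #(S.erase i) = N := by rw [card_erase_of_mem hi, hN, Nat.add_sub_cancel]
  obtain ⟨r, hr⟩ : ∃ r : ℝ, r = ∑ l ∈ S, (if group p (τ l) = h then 1 else 0) := ⟨_, rfl⟩
  have hr' : r = #{l ∈ S | group p (τ l) = h} := by rw [hr, sum_boole]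
  have hrN : r ≤ N + 1 := by
    rw [hr']
    exact_mod_cast (card_filter_le _ _).trans_eq hN
  have hrest : (#{l ∈ S | ¬ group p (τ l) = h} : ℝ) = N + 1 - r := by
    have := card_filter_add_card_filter_not (s := S) fun l => group p (τ l) = h
    rw [hN] at this
    rw [hr', eq_sub_iff_add_eq']
    exact_mod_cast this
  have hsum : ∑ j ∈ S, potential #(S.erase i)
        (deviation p α (S.erase i) (τ * Equiv.swap i j) h) =
      r * potential N (r - 1 - α h * N) + (N + 1 - r) * potential N (r - α h * N) := by
    rw [← sum_filter_add_sum_filter_not S fun l => group p (τ l) = h]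
    congr 1
    · rw [hr', ← nsmul_eq_mul, ← hr', ← sum_const]
      refine sum_congr rfl fun j hj => ?_
      rw [mem_filter] at hj
      rw [deviation_erase_mul_swap p α hi hj.1, if_pos hj.2, hc, ← hr]
    · rw [← hrest, ← nsmul_eq_mul, ← sum_const]
      refine sum_congr rfl fun j hj => ?_
      rw [mem_filter] at hj
      rw [deviation_erase_mul_swap p α hi hj.1, if_neg hj.2, hc, ← hr, sub_zero]
  rw [hsum, deviation, ← hr, hN]
  push_cast
  exact abs_add_potential_le N r (α h) hrN

/-- The expected excess of a single classification, multiplied by `#S`. -/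
theorem abs_sum_depth_sub_le {p : Fin k → Fin n} (α : Fin (k + 1) → ℝ) (lam : ComparisonTree k)
    (S : Finset (Fin n)) (τ : Equiv.Perm (Fin n)) :
    |∑ j ∈ S, ((leafDepth lam.1 (group p (τ j)) : ℝ) -
      ∑ h : Fin (k + 1), leafDepth lam.1 h * α h)| ≤
      k * ∑ h, |deviation p α S τ h| := by
  have h1 : ∑ j ∈ S, ((leafDepth lam.1 (group p (τ j)) : ℝ) -
      ∑ h : Fin (k + 1), leafDepth lam.1 h * α h) =
      ∑ h : Fin (k + 1), (leafDepth lam.1 h : ℝ) * deviation p α S τ h := by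
    simp only [deviation, mul_sub, sum_sub_distrib, mul_sum]
    congr 1
    · rw [sum_comm]
      exact sum_congr rfl fun j _ => by simp
    · rw [sum_const, nsmul_eq_mul, mul_sum]
      exact sum_congr rfl fun h _ => by ring
  rw [h1, mul_sum]
  refine (abs_sum_le_sum_abs _ _).trans (sum_le_sum fun h _ => ?_)
  rw [abs_mul, Nat.abs_cast]
  gcongr
  exact leafDepth_le lam h

/-- The potential bounds the total excess, averaged over the ways to fill the positions in `S` with
the values that `τ` has there. -/
theorem abs_sum_excess_le {p : Fin k → Fin n} (hp : StrictMono p) (α : Fin (k + 1) → ℝ)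
    (T : ClassTree k n) (S : Finset (Fin n)) (hT : T.CoversOnce S) (τ : Equiv.Perm (Fin n)) :
    |∑ σ ∈ agreeOff S τ,
        excess (pivotSeq p) (fun lam => ∑ h : Fin (k + 1), leafDepth lam.1 h * α h) T σ| ≤
      (#S).factorial * (k * ∑ h, potential #S (deviation p α S τ h)) := by
  induction T generalizing S τ with
  | leaf =>
    simp only [excess_leaf, sum_const_zero, abs_zero, potential]
    positivity
  | node i lam child ih =>
    obtain ⟨hi, hchild⟩ := hT
    have hfact : (#S).factorial = #S * (#(S.erase i)).factorial := by
      rw [card_erase_of_mem hi, Nat.mul_factorial_pred (card_pos.2 ⟨i, hi⟩).ne']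
    have hinner : ∀ j ∈ S, ∑ σ ∈ agreeOff (S.erase i) (τ * Equiv.swap i j),
        excess (pivotSeq p) (fun lam => ∑ h : Fin (k + 1), leafDepth lam.1 h * α h)
          (.node i lam child) σ =
        (#(S.erase i)).factorial *
          ((leafDepth lam.1 (group p (τ j)) : ℝ) - ∑ h : Fin (k + 1), leafDepth lam.1 h * α h) +
        ∑ σ ∈ agreeOff (S.erase i) (τ * Equiv.swap i j),
          excess (pivotSeq p) (fun lam => ∑ h : Fin (k + 1), leafDepth lam.1 h * α h)
            (child (group p (τ j))) σ := by
      intro j hj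
      rw [← card_agreeOff (S.erase i) (τ * Equiv.swap i j), ← nsmul_eq_mul, ← sum_const,
        ← sum_add_distrib]
      refine sum_congr rfl fun σ hσ => ?_
      rw [excess_node, outcome_pivotSeq hp, numComparisons_pivotSeq hp,
        ((mem_agreeOff_erase hi hj).1 hσ).2]
    rw [sum_agreeOff hi, sum_congr rfl hinner, sum_add_distrib, ← mul_sum]
    calc _ ≤ (#(S.erase i)).factorial * (k * ∑ h, |deviation p α S τ h|) +
          ∑ j ∈ S, (#(S.erase i)).factorial * (k * ∑ h, potential #(S.erase i)
            (deviation p α (S.erase i) (τ * Equiv.swap i j) h)) := by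
          refine (abs_add_le _ _).trans (add_le_add ?_ ?_)
          · rw [abs_mul, Nat.abs_cast]
            gcongr
            exact abs_sum_depth_sub_le α lam S τ
          · exact (abs_sum_le_sum_abs _ _).trans
              (sum_le_sum fun j _ => ih _ _ (hchild _) _)
      _ = (#(S.erase i)).factorial * (k * ∑ h, (|deviation p α S τ h| +
          ∑ j ∈ S, potential #(S.erase i)
            (deviation p α (S.erase i) (τ * Equiv.swap i j) h))) := by
          rw [← mul_sum, ← mul_sum, sum_comm, sum_add_distrib]
          ring
      _ ≤ (#(S.erase i)).factorial * (k * ∑ h, #S * potential #S (deviation p α S τ h)) := by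
          gcongr
          exact sum_potential_erase_add_abs_le p α hi τ _
      _ = _ := by
          rw [hfact, ← mul_sum]
          push_cast
          ring

end Excess

/-! ### Conditioning on the pivots -/

section Conditional

variable {n k : ℕ}

/-- The positions that do not hold a pivot. -/
def nonPivotPositions (k n : ℕ) : Finset (Fin n) := {i | k ≤ (i : ℕ)}

theorem card_nonPivotPositions (hk : k ≤ n) : #(nonPivotPositions k n) = n - k := by
  have h := card_filter_add_card_filter_not (s := (univ : Finset (Fin n))) fun i => (i : ℕ) < k
  rw [Fin.card_filter_val_lt, min_eq_right hk, card_univ, Fintype.card_fin] at h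
  simp only [not_lt] at h
  rw [nonPivotPositions]
  omega

theorem pivotSet_eq_of_mem_agreeOff {σ τ : Equiv.Perm (Fin n)}
    (h : σ ∈ agreeOff (nonPivotPositions k n) τ) : pivotSet k σ = pivotSet k τ := by
  refine image_congr fun i hi => mem_agreeOff.1 h i ?_
  simpa [nonPivotPositions] using hi

theorem image_nonPivotPositions (σ : Equiv.Perm (Fin n)) :
    (nonPivotPositions k n).image σ = (pivotSet k σ)ᶜ := by
  ext v
  obtain ⟨i, rfl⟩ := σ.surjective v
  simp [nonPivotPositions, pivotSet]

theorem card_filter_group_eq {p : Fin k → Fin n} (hp : StrictMono p) {τ : Equiv.Perm (Fin n)}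
    (hτ : pivotSet k τ = univ.image p) (h : Fin (k + 1)) :
    #{l ∈ nonPivotPositions k n | group p (τ l) = h} = groupSize p h := by
  rw [← card_group_eq hp, ← hτ, ← image_nonPivotPositions, filter_image,
    card_image_of_injective _ τ.injective]

theorem avgCost_eq (lam : ComparisonTree k) (a : Fin (k + 1) → ℕ) :
    avgCost lam a = ∑ h : Fin (k + 1), leafDepth lam.1 h * ((a h : ℝ) / ∑ h, (a h : ℝ)) := by
  rw [avgCost, cost]
  push_cast
  rw [sum_div]
  exact sum_congr rfl fun h _ => by rw [mul_div_assoc]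

/-- At the start the values still to be classified are split exactly in the proportions of the
group sizes. -/
theorem deviation_nonPivotPositions {p : Fin k → Fin n} (hkn : k < n) (hp : StrictMono p)
    {τ : Equiv.Perm (Fin n)} (hτ : pivotSet k τ = univ.image p) (h : Fin (k + 1)) :
    deviation p (fun h => (groupSize p h : ℝ) / ∑ h, (groupSize p h : ℝ))
      (nonPivotPositions k n) τ h = 0 := by
  have hsum : ∑ h, (groupSize p h : ℝ) = #(nonPivotPositions k n) := by
    simp only [← card_filter_group_eq hp hτ]
    exact_mod_cast (card_eq_sum_card_fiberwise (s := nonPivotPositions k n) (t := univ)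
      (f := fun l => group p (τ l)) fun _ _ => mem_univ _).symm
  have hpos : (#(nonPivotPositions k n) : ℝ) ≠ 0 := by
    rw [card_nonPivotPositions hkn.le]
    exact_mod_cast (Nat.sub_pos_of_lt hkn).ne'
  rw [deviation, hsum, div_mul_cancel₀ _ hpos, sum_boole, card_filter_group_eq hp hτ, sub_self]

theorem abs_condExpectation_sub_treeSum_le (hkn : k < n) {T : ClassTree k n}
    (hT : T.IsClassificationTree) {p : Fin k → Fin n} (hp : StrictMono p) :
    |condExpectation hkn.le p (T.partitionCost hkn.le) - treeSum hkn.le T p| ≤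
      2 * k * (k + 1) * √n := by
  set D : Finset (Equiv.Perm (Fin n)) := {σ | pivots hkn.le σ = p} with hD
  have hmem : ∀ {σ}, σ ∈ D ↔ pivotSet k σ = univ.image p := by
    simp [hD, pivots_eq_iff hkn.le _ hp]
  set X := excess (pivotSeq p) (fun lam => avgCost lam (groupSize p)) T with hX
  have hdiff : condExpectation hkn.le p (T.partitionCost hkn.le) - treeSum hkn.le T p =
      (∑ σ ∈ D, X σ) / #D := by
    simp only [hX, excess, condExpectation, treeSum, ← hD, div_mul_eq_mul_div, ← sum_div,
      ← sub_div, sum_sub_distrib]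
    congr 2
    · refine sum_congr rfl fun σ hσ => ?_
      rw [ClassTree.partitionCost, (mem_filter.1 hσ).2]
    · rw [sum_comm]
      refine sum_congr rfl fun lam _ => ?_
      rw [sum_mul]
      refine sum_congr rfl fun σ hσ => ?_
      rw [ClassTree.treeUses, (mem_filter.1 hσ).2]
  set S := nonPivotPositions k n with hS
  have hclass : ∀ τ ∈ D, |∑ σ ∈ agreeOff S τ, X σ| ≤
      (#S).factorial * (2 * k * (k + 1) * √n) := by
    intro τ hτ
    have h := abs_sum_excess_le hp (fun h => (groupSize p h : ℝ) / ∑ h, (groupSize p h : ℝ)) T S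
      hT τ
    simp only [hS, deviation_nonPivotPositions hkn hp (hmem.1 hτ), ← avgCost_eq] at h
    refine h.trans ?_
    have hsqrt : √(#(nonPivotPositions k n) : ℝ) ≤ √n := by
      refine Real.sqrt_le_sqrt ?_
      rw [card_nonPivotPositions hkn.le]
      exact_mod_cast Nat.sub_le n k
    simp only [potential, sum_const, card_univ, Fintype.card_fin, nsmul_eq_mul, ne_eq,
      OfNat.ofNat_ne_zero, not_false_eq_true, zero_pow, zero_div, zero_add, hS]
    push_cast
    calc _ ≤ ((#(nonPivotPositions k n)).factorial : ℝ) * (k * ((k + 1) * (2 * √n))) := by gcongr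
      _ = _ := by ring
  -- Averaging over the classes of inputs that share their first `k` elements.
  have hswap : (#S).factorial * ∑ σ ∈ D, X σ = ∑ τ ∈ D, ∑ σ ∈ agreeOff S τ, X σ := by
    rw [sum_comm' (t' := D) (s' := fun σ => agreeOff S σ), mul_sum]
    · refine sum_congr rfl fun σ _ => ?_
      rw [sum_const, card_agreeOff, nsmul_eq_mul]
    · intro τ σ
      rw [mem_agreeOff_comm (τ := σ)]
      refine ⟨fun h => ⟨mem_agreeOff_comm.2 (mem_agreeOff_comm.1 h.2), ?_⟩,
        fun h => ⟨?_, h.1⟩⟩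
      · exact hmem.2 ((pivotSet_eq_of_mem_agreeOff h.2).trans (hmem.1 h.1))
      · exact hmem.2 ((pivotSet_eq_of_mem_agreeOff h.1).symm.trans (hmem.1 h.2))
  have hbound : |∑ σ ∈ D, X σ| ≤ 2 * k * (k + 1) * √n * #D := by
    have hpos : (0 : ℝ) < (#S).factorial := by positivity
    refine le_of_mul_le_mul_left ?_ hpos
    rw [← abs_of_pos hpos, ← abs_mul, abs_of_pos hpos, hswap]
    refine ((abs_sum_le_sum_abs _ _).trans (sum_le_sum hclass)).trans_eq ?_
    rw [sum_const, nsmul_eq_mul]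
    ring
  rw [hdiff, abs_div, Nat.abs_cast]
  exact div_le_of_le_mul₀ (by positivity) (by positivity) hbound

end Conditional

end MultiPivot

theorem mainTheorem2 (k : ℕ) (hk : 1 ≤ k) :
    ∃ ε : ℝ, 0 < ε ∧ ∃ C : ℝ, ∀ (n : ℕ) (hn : k < n) (T : MultiPivot.ClassTree k n),
      T.IsClassificationTree →
        (∀ p ∈ MultiPivot.pivotChoices k n,
          |MultiPivot.condExpectation hn.le p (T.partitionCost hn.le) -
              MultiPivot.treeSum hn.le T p| ≤ C * (n : ℝ) ^ (1 - ε)) ∧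
        |MultiPivot.expectation (T.partitionCost hn.le) -
            1 / (n.choose k : ℝ) *
              ∑ p ∈ MultiPivot.pivotChoices k n, MultiPivot.treeSum hn.le T p| ≤
          C * (n : ℝ) ^ (1 - ε) := by
  refine ⟨1 / 2, by norm_num, 2 * k * (k + 1), fun n hn T hT => ?_⟩
  have hpow : (n : ℝ) ^ (1 - 1 / 2 : ℝ) = √n := by
    rw [Real.sqrt_eq_rpow]
    norm_num
  rw [hpow]
  have hcond : ∀ p ∈ MultiPivot.pivotChoices k n,
      |MultiPivot.condExpectation hn.le p (T.partitionCost hn.le) -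
        MultiPivot.treeSum hn.le T p| ≤ 2 * k * (k + 1) * √n := fun p hp =>
    MultiPivot.abs_condExpectation_sub_treeSum_le hn hT (MultiPivot.mem_pivotChoices.1 hp)
  refine ⟨hcond, ?_⟩
  have hpos : (0 : ℝ) < n.choose k := by exact_mod_cast Nat.choose_pos hn.le
  rw [MultiPivot.expectation_eq_sum_condExpectation hn.le, ← mul_sub, ← Finset.sum_sub_distrib,
    abs_mul, abs_of_pos (one_div_pos.2 hpos), one_div, inv_mul_le_iff₀ hpos]
  refine ((Finset.abs_sum_le_sum_abs _ _).trans (Finset.sum_le_sum hcond)).trans_eq ?_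
  rw [Finset.sum_const, MultiPivot.card_pivotChoices, nsmul_eq_mul]
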